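/- Let $E$ be an $n$-dimensional Euclidean space and $L\subset E$ a (full-rank) lattice. Its minimal vectors are its nonzero vectors of smallest norm; they form a finite set $S(L)$, and $s(L)=|S(L)|/2$ is the half kissing number, i.e. the number of pairs $\pm x$ of minimal vectors. The maximal index of $L$ is the maximum of the indices $[L:M]$, where $M$ runs through the sublattices of $L$ spanned by $n$ linearly independent minimal vectors of $L$. If $L$ has maximal index $2$, its length is the smallest cardinality $|X|$ of a nonempty set $X$ of linearly independent minimal vectors of $L$ with $\sum_{x\in X}x\equiv 0 \bmod 2L$. Theorem. Define $B(6)=19$, $B(7)=24$, $B(8)=32$, $B(9)=37$, $B(10)=44$, and for $n\ge 11$ $$B(n)=\begin{cases}(2n^2+24n-45)/9 & n\equiv 0 \pmod 6,\\ (2n^2+20n-13)/9 & n\equiv 1 \pmod 6,\\ (2n^2+22n-25)/9 & n\equiv 2 \pmod 6,\\ (2n^2+24n-54)/9 & n\equiv 3 \pmod 6,\\ (2n^2+20n-4)/9 & n\equiv 4 \pmod 6,\\ (2n^2+22n-34)/9 & n\equiv 5 \pmod 6.\end{cases}$$ If $L$ has dimension $n\ge 6$, maximal index $2$ and length $n$,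 then $s(L)\le B(n)$. Moreover $B(n)<\frac{n(n+1)}2$ for all $n\ge 6$, and $B(n)\sim \frac{2n^2}9$ as $n\to\infty$; consequently, for every $\varepsilon>0$ there is $N$ such that $s(L)\le (1+\varepsilon)\frac{2n^2}9$ for all such lattices $L$ of dimension $n\ge N$. -/

import Mathlib

open Filter Asymptotics

universe u

/-- The set `S(L)` of minimal vectors of `L`: the nonzero vectors of `L` of smallest norm. -/
def minimalVectors {E : Type*} [NormedAddCommGroup E] (L : Submodule ℤ E) : Set E :=
  {x | x ∈ L ∧ x ≠ 0 ∧ ∀ y ∈ L, y ≠ 0 → ‖x‖ ≤ ‖y‖}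

/-- A lattice has only finitely many minimal vectors, so that counting them with `Set.ncard`
gives the true cardinality. -/
theorem minimalVectors_finite {E : Type*} [NormedAddCommGroup E] [InnerProductSpace ℝ E]
    [FiniteDimensional ℝ E] (L : Submodule ℤ E) [DiscreteTopology L] :
    (minimalVectors L).Finite := by
  rcases (minimalVectors L).eq_empty_or_nonempty with h | ⟨x, hx⟩
  · rw [h]; exact Set.finite_empty
  · have hL : DiscreteTopology L.toAddSubgroup := ‹DiscreteTopology L›
    have hc : IsClosed (L.toAddSubgroup : Set E) := AddSubgroup.isClosed_of_discrete
    have : ProperSpace E := FiniteDimensional.proper ℝ E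
    have hfin := Metric.finite_isBounded_inter_isClosed hL.isDiscrete
      (Metric.isBounded_closedBall (x := (0 : E)) (r := ‖x‖)) hc
    refine hfin.subset fun y hy => ⟨?_, hy.1⟩
    simpa using hy.2.2 x hx.1 hx.2.1

/-- The half kissing number `s(L) = |S(L)| / 2`, i.e. the number of pairs `±x` of minimal
vectors of `L`. -/
noncomputable def halfKissingNumber {E : Type*} [NormedAddCommGroup E] (L : Submodule ℤ E) : ℝ :=
  ((minimalVectors L).ncard : ℝ) / 2

/-- The maximal index of `L` is `k`: the greatest index `[L : M]`, where `M` runs through the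
sublattices of `L` spanned by `n = dim E` independent minimal vectors of `L`, is `k`. (In
particular such an `M` exists, i.e. `L` is well rounded.) -/
def HasMaximalIndex {E : Type*} [NormedAddCommGroup E] [InnerProductSpace ℝ E]
    (L : Submodule ℤ E) (k : ℕ) : Prop :=
  IsGreatest
    {i : ℕ | ∃ v : Fin (Module.finrank ℝ E) → E,
      (∀ j, v j ∈ minimalVectors L) ∧ LinearIndependent ℝ v ∧
      i = (Submodule.span ℤ (Set.range v)).toAddSubgroup.relIndex L.toAddSubgroup} k

/-- The length of `L` is `l`: the least cardinality of a nonempty set `X` of independent minimal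
vectors of `L` with `∑ x ∈ X, x ≡ 0 mod 2L` is `l`. -/
def HasLength {E : Type*} [NormedAddCommGroup E] [InnerProductSpace ℝ E]
    (L : Submodule ℤ E) (l : ℕ) : Prop :=
  IsLeast
    {c : ℕ | ∃ X : Finset E, X.Nonempty ∧ (∀ x ∈ X, x ∈ minimalVectors L) ∧
      LinearIndependent ℝ (fun x : X => (x : E)) ∧
      (∃ y ∈ L, ∑ x ∈ X, x = (2 : ℤ) • y) ∧ X.card = c} l

/-- The table of upper bounds for the half kissing number, as a function of the dimension
(meaningful for `n ≥ 6`). -/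
noncomputable def kissingBound (n : ℕ) : ℝ :=
  if n = 6 then 19
  else if n = 7 then 24
  else if n = 8 then 32
  else if n = 9 then 37
  else if n = 10 then 44
  else if n % 6 = 0 then (2 * (n : ℝ) ^ 2 + 24 * n - 45) / 9
  else if n % 6 = 1 then (2 * (n : ℝ) ^ 2 + 20 * n - 13) / 9
  else if n % 6 = 2 then (2 * (n : ℝ) ^ 2 + 22 * n - 25) / 9
  else if n % 6 = 3 then (2 * (n : ℝ) ^ 2 + 24 * n - 54) / 9
  else if n % 6 = 4 then (2 * (n : ℝ) ^ 2 + 20 * n - 4) / 9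
  else (2 * (n : ℝ) ^ 2 + 22 * n - 34) / 9

/-!
A lattice `L` of dimension and length `n` carries a *half frame*: minimal vectors `b 1, …, b n`
forming a basis of the space whose half sum lies in `L`. Exchanging a member of the frame for
another minimal vector `z` cannot produce an index above `2`, which bounds the coordinates of `z`;
and a minimal vector with integral coordinates and at least two nonzero ones would give a relation
modulo `2L` shorter than `n`. So, up to sign, every minimal vector is either in the frame or a half
sum `½ ∑ ± b i` (`IsHalfFrame.minimal_cases`). Hence `s(L) ≤ n + |F| / 2`, where `F ⊆ (ℤ/2ℤ)ⁿ` is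
the family of sign vectors of the minimal half sums, and it remains to bound `|F|`.

Consider four members of `F`, each of which differs from the three others somewhere
(`IsScattered`). The four half sums together with the `b i`, where `i` runs through the places at
which the four signs have even sum, are independent, and their sum lies in `2L`. As the length is
`n`, there are exactly four odd places. The new family is then itself a half frame, so any further
minimal half sum has all coordinates `±½` in it too, which fixes its parity on the four odd places
(`sum_odd_eq_one`). These two facts, with the symmetry `x ↦ x + 1`, are all that is used of `L`
(`IsAdmissible`).

They survive the deletion of a coordinate. The deletion of the `i`-th coordinate identifies two
members of `F` precisely when they differ only in that coordinate. View `F` as a graph, joining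
members that differ in one coordinate. If some vertex has degree at least four, its neighbours form
a scattered quadruple, and the parity condition leaves at most six identified pairs in a suitable
direction. Otherwise all degrees are at most three, and the direction with the fewest edges
accounts for at most a share `1 / n` of them. So some deletion loses at most `6` or at most
`3 |F| / (2 n)` members (`IsAdmissible.exists_contraction`). In dimension five, a count of
neighbours gives `|F| ≤ 20` (`IsAdmissible.card_le_twenty`). Induction then yields `|F| ≤ 26` for
`n = 6`, `|F| ≤ 33` for `n = 7` and `9 |F| ≤ 4 n² + 22 n - 26` for all `n ≥ 6`, which is at least
as good as the table.
-/

/-! ### Frames of minimal vectors -/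

section Frames

theorem neg_mem_minimalVectors {E : Type*} [NormedAddCommGroup E] {L : Submodule ℤ E} {x : E}
    (hx : x ∈ minimalVectors L) : -x ∈ minimalVectors L :=
  ⟨L.neg_mem hx.1, neg_ne_zero.2 hx.2.1, by simpa using hx.2.2⟩

theorem span_range_le_of_minimal {E : Type*} [NormedAddCommGroup E] {ι : Type*}
    {L : Submodule ℤ E} {v : ι → E} (hv : ∀ i, v i ∈ minimalVectors L) :
    Submodule.span ℤ (Set.range v) ≤ L := by
  rw [Submodule.span_le]
  rintro _ ⟨i, rfl⟩
  exact (hv i).1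

variable {E : Type*} [NormedAddCommGroup E] [InnerProductSpace ℝ E] {ι : Type*} [Fintype ι]

/-- An independent family of minimal vectors whose sum lies in `2L` has at least as many members
as the length of `L`. -/
theorem HasLength.le_card {L : Submodule ℤ E} {l : ℕ} (hL : HasLength L l) [Nonempty ι]
    {v : ι → E} (hv : ∀ i, v i ∈ minimalVectors L) (hli : LinearIndependent ℝ v)
    (hsum : ∃ y ∈ L, ∑ i, v i = (2 : ℤ) • y) : l ≤ Fintype.card ι := by
  classical
  refine hL.2 ⟨Finset.univ.image v, Finset.univ_nonempty.image v, ?_, ?_, ?_, ?_⟩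
  · intro x hx
    obtain ⟨i, -, rfl⟩ := Finset.mem_image.1 hx
    exact hv i
  · have h : LinearIndepOn ℝ id (Set.range v) := hli.linearIndepOn_id
    have : ((Finset.univ.image v : Finset E) : Set E) = Set.range v := by simp
    rw [← this] at h
    exact h
  · rwa [Finset.sum_image hli.injective.injOn]
  · rw [Finset.card_image_of_injective _ hli.injective, Finset.card_univ]

/-- A half frame of `L`: a basis of `E` consisting of minimal vectors whose half sum lies
in `L`. -/
def IsHalfFrame (L : Submodule ℤ E) (b : Module.Basis ι ℝ E) : Prop :=
  (∀ i, b i ∈ minimalVectors L) ∧ ∃ y ∈ L, ∑ i, b i = (2 : ℤ) • y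

variable [FiniteDimensional ℝ E] {L : Submodule ℤ E} [DiscreteTopology L] [IsZLattice ℝ L]

/-- The index of a full-rank sublattice is not the junk value `0` of an infinite index. -/
theorem relIndex_span_basis_ne_zero (b : Module.Basis ι ℝ E)
    (hb : Submodule.span ℤ (Set.range b) ≤ L) :
    (Submodule.span ℤ (Set.range b)).toAddSubgroup.relIndex L.toAddSubgroup ≠ 0 := by
  borelize E
  have h := ZLattice.covolume_div_covolume_eq_relIndex' (Submodule.span ℤ (Set.range b)) L hb
  intro h0
  rw [h0, Nat.cast_zero] at h
  exact (div_pos (ZLattice.covolume_pos _ _) (ZLattice.covolume_pos L _)).ne' h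

theorem relIndex_span_eq_one_or_two (hL : HasMaximalIndex L 2) (b : Module.Basis ι ℝ E)
    (hb : ∀ i, b i ∈ minimalVectors L) :
    (Submodule.span ℤ (Set.range b)).toAddSubgroup.relIndex L.toAddSubgroup = 1 ∨
    (Submodule.span ℤ (Set.range b)).toAddSubgroup.relIndex L.toAddSubgroup = 2 := by
  have h0 := relIndex_span_basis_ne_zero b (span_range_le_of_minimal hb)
  have h2 : (Submodule.span ℤ (Set.range b)).toAddSubgroup.relIndex L.toAddSubgroup ≤ 2 := by
    let e : ι ≃ Fin (Module.finrank ℝ E) :=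
      Fintype.equivFinOfCardEq (Module.finrank_eq_card_basis b).symm
    refine hL.2 ⟨b.reindex e, fun j => ?_, (b.reindex e).linearIndependent, ?_⟩
    · rw [Module.Basis.reindex_apply]; exact hb _
    · rw [Module.Basis.range_reindex]
  omega

theorem two_zsmul_mem_span (hL : HasMaximalIndex L 2) (b : Module.Basis ι ℝ E)
    (hb : ∀ i, b i ∈ minimalVectors L) {x : E} (hx : x ∈ L) :
    (2 : ℤ) • x ∈ Submodule.span ℤ (Set.range b) := by
  rcases relIndex_span_eq_one_or_two hL b hb with h | h
  · exact Submodule.smul_mem _ _ (AddSubgroup.relIndex_eq_one.1 h hx)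
  · have := AddSubgroup.two_smul_mem_of_index_two h ⟨x, hx⟩
    rw [AddSubgroup.mem_addSubgroupOf] at this
    rw [two_zsmul, ← two_nsmul]
    exact this

/-- With respect to a half frame, the coordinates of a lattice vector are all integers or all
halves of odd integers. -/
theorem IsHalfFrame.coords_of_mem (hL : HasMaximalIndex L 2) [Nonempty ι]
    {b : Module.Basis ι ℝ E} (hb : IsHalfFrame L b) {x : E} (hx : x ∈ L) :
    (∀ i, ∃ m : ℤ, b.repr x i = m) ∨ ∀ i, ∃ m : ℤ, b.repr x i = m + 1 / 2 := by
  obtain ⟨hmin, y, hy, hsum⟩ := hb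
  have hycoord : ∀ i, b.repr y i = 1 / 2 := by
    intro i
    have h := congrArg (fun v => b.repr v i) hsum
    classical
    simp [Finsupp.single_apply] at h
    linarith
  have hyM : y ∉ Submodule.span ℤ (Set.range b) := by
    rw [Module.Basis.mem_span_iff_repr_mem]
    intro h
    obtain ⟨i⟩ := ‹Nonempty ι›
    obtain ⟨m, hm⟩ := h i
    rw [hycoord] at hm
    have : (2 * m : ℝ) = 1 := by
      have : (m : ℝ) = 1 / 2 := by simpa using hm
      linarith
    have : 2 * m = 1 := by exact_mod_cast this
    omega
  -- Since the half sum `y` is not in the span, the index is `2`, and every lattice vector is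
  -- congruent to `0` or to `y` modulo the span.
  have h2 := (relIndex_span_eq_one_or_two hL b hmin).resolve_left
    fun h => hyM (AddSubgroup.relIndex_eq_one.1 h hy)
  by_cases hxM : x ∈ Submodule.span ℤ (Set.range b)
  · left
    intro i
    obtain ⟨m, hm⟩ := (b.mem_span_iff_repr_mem ℤ x).1 hxM i
    exact ⟨m, by simpa using hm.symm⟩
  · right
    have h := AddSubgroup.add_mem_iff_of_index_two h2 (a := ⟨x, hx⟩) (b := ⟨y, hy⟩)
    simp only [AddSubgroup.mem_addSubgroupOf, AddSubgroup.coe_add,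
      Submodule.mem_toAddSubgroup, hxM, hyM, iff_self, iff_true] at h
    intro i
    obtain ⟨m, hm⟩ := (b.mem_span_iff_repr_mem ℤ _).1 h i
    refine ⟨m - 1, ?_⟩
    have hm' : (m : ℝ) = b.repr x i + b.repr y i := by simpa using hm
    rw [hycoord] at hm'
    push_cast
    linarith

/-- Exchanging `b i` for a minimal vector `z` gives a sublattice of index at most `2`, which
contains `∑ b = 2y`; the coordinate of `2y` at `z` is the inverse of the `i`-th coordinate of `z`,
so this inverse is an integer. -/
theorem IsHalfFrame.inv_coord_int (hL : HasMaximalIndex L 2)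
    {b : Module.Basis ι ℝ E} (hb : IsHalfFrame L b) {z : E} (hz : z ∈ minimalVectors L) {i : ι}
    (hi : b.repr z i ≠ 0) : ∃ m : ℤ, (b.repr z i)⁻¹ = m := by
  classical
  obtain ⟨hmin, y, hy, hsum⟩ := hb
  set v : ι → E := Function.update b i z with hv
  have hli : LinearIndependent ℝ v :=
    b.linearIndependent.update i z
      ⟨1, one_mem _, b.repr z, mem_nonZeroDivisors_of_ne_zero hi, by simp⟩
  have : Nonempty ι := ⟨i⟩
  let b' : Module.Basis ι ℝ E := basisOfLinearIndependentOfCardEqFinrank hli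
    (Module.finrank_eq_card_basis b).symm
  have hb' : ∀ k, b' k = v k := fun k => by simp [b']
  have hmin' : ∀ k, b' k ∈ minimalVectors L := by
    intro k
    rw [hb', hv]
    by_cases hk : k = i
    · subst hk; simpa using hz
    · simpa [hk] using hmin k
  have hmem := two_zsmul_mem_span hL b' hmin' hy
  obtain ⟨m, hm⟩ := (b'.mem_span_iff_repr_mem ℤ _).1 hmem i
  have hfun : b'.coord i = (b.repr z i)⁻¹ • b.coord i := by
    refine b'.ext fun k => ?_
    rw [Module.Basis.coord_apply, Module.Basis.repr_self, hb', hv]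
    by_cases hk : k = i
    · subst hk; simp [hi]
    · simp [hk]
  refine ⟨m, ?_⟩
  rw [← hsum, ← Module.Basis.coord_apply, hfun] at hm
  simpa [Finsupp.finsetSum_apply, Finsupp.single_apply] using hm.symm

theorem Int.eq_one_or_neg_one_of_inv {a m : ℤ} (h : ((a : ℝ))⁻¹ = m) (ha : (a : ℝ) ≠ 0) :
    a = 1 ∨ a = -1 := by
  have : (a * m : ℝ) = 1 := by rw [← h]; exact mul_inv_cancel₀ ha
  exact Int.eq_one_or_neg_one_of_mul_eq_one (by exact_mod_cast this)

/-- If the length is the dimension, a minimal vector is, up to sign, either a member of a given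
half frame or a signed half sum of the whole frame. -/
theorem IsHalfFrame.minimal_cases (hL : HasMaximalIndex L 2) [Nonempty ι]
    (hlen : HasLength L (Fintype.card ι)) {b : Module.Basis ι ℝ E} (hb : IsHalfFrame L b)
    {z : E} (hz : z ∈ minimalVectors L) :
    (∃ i, z = b i ∨ z = -b i) ∨ ∀ i, b.repr z i = 1 / 2 ∨ b.repr z i = -(1 / 2) := by
  classical
  rcases hb.coords_of_mem hL hz.1 with hint | hhalf
  · left
    have h01 : ∀ i, b.repr z i = 0 ∨ b.repr z i = 1 ∨ b.repr z i = -1 := by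
      intro i
      by_cases h0 : b.repr z i = 0
      · exact Or.inl h0
      · right
        obtain ⟨a, ha⟩ := hint i
        obtain ⟨m, hm⟩ := hb.inv_coord_int hL hz h0
        rw [ha] at hm h0 ⊢
        rcases Int.eq_one_or_neg_one_of_inv hm h0 with h | h <;> subst h <;> simp
    obtain ⟨i, hi⟩ : ∃ i, b.repr z i ≠ 0 := by
      by_contra! h
      exact hz.2.1 (b.repr.map_eq_zero_iff.1 (Finsupp.ext h))
    refine ⟨i, ?_⟩
    -- All other coordinates vanish: otherwise `z` together with the frame vectors outside
    -- its support would be too short.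
    have hother : ∀ k, k ≠ i → b.repr z k = 0 := by
      by_contra! hcon
      obtain ⟨k, hki, hk⟩ := hcon
      let T := {j : ι // b.repr z j = 0}
      let w : Option T → E := fun o => o.elim z fun j => b j
      have hmin : ∀ o, w o ∈ minimalVectors L := by
        rintro (_ | j)
        · exact hz
        · exact hb.1 j
      have hli : LinearIndependent ℝ w := by
        rw [Fintype.linearIndependent_iff]
        intro g hg
        rw [Fintype.sum_option] at hg
        have hnone : g none = 0 := by
          have := congrArg (fun u => b.repr u i) hg
          simp only [w, map_add, map_smul, map_sum, Finsupp.add_apply, Finsupp.finsetSum_apply,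
            Finsupp.smul_apply, Option.elim, map_zero, Finsupp.zero_apply, smul_eq_mul] at this
          rw [Finset.sum_eq_zero, add_zero] at this
          · exact (mul_eq_zero.1 this).resolve_right hi
          · intro j _
            have : (j : ι) ≠ i := fun h => hi (h ▸ j.2)
            simp [this]
        rw [hnone, zero_smul, zero_add] at hg
        have h2 := Fintype.linearIndependent_iff.1
          (b.linearIndependent.comp (Subtype.val : T → ι) Subtype.val_injective)
          (fun j => g (some j)) hg
        rintro (_ | j)
        · exact hnone
        · exact h2 j
      have hsum : ∃ y ∈ L, ∑ o, w o = (2 : ℤ) • y := by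
        obtain ⟨y, hy, hyb⟩ := hb.2
        -- Coordinatewise, `∑ w - ∑ b` is `-2` where `z` has coordinate `-1`, and `0` elsewhere.
        refine ⟨y - ∑ j, (if b.repr z j = -1 then b j else 0),
          L.sub_mem hy (L.sum_mem fun j _ => ?_), ?_⟩
        · split_ifs
          · exact (hb.1 j).1
          · exact L.zero_mem
        · rw [smul_sub, ← hyb, Fintype.sum_option]
          apply b.ext_elem
          intro j
          have hT : (∑ t : T, b.repr (b t) j) = if b.repr z j = 0 then 1 else 0 := by
            split_ifs with h
            · rw [Finset.sum_eq_single (⟨j, h⟩ : T)]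
              · simp
              · intro t _ ht
                have : (t : ι) ≠ j := fun h' => ht (Subtype.ext h')
                simp [this]
              · simp
            · refine Finset.sum_eq_zero fun t _ => ?_
              have : (t : ι) ≠ j := fun h' => h (h' ▸ t.2)
              simp [this]
          have hS : (∑ x, b.repr (if b.repr z x = -1 then b x else 0) j) =
              if b.repr z j = -1 then 1 else 0 := by
            rw [Finset.sum_eq_single j]
            · split_ifs <;> simp
            · intro t _ ht
              split_ifs <;> simp [ht]
            · simp
          have hB : (∑ x, b.repr (b x) j) = 1 := by
            simp [Finsupp.single_apply]
          simp only [w, Option.elim, map_add, map_sum, map_sub, map_zsmul, Finsupp.add_apply,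
            Finsupp.finsetSum_apply, Finsupp.sub_apply, Finsupp.smul_apply]
          rw [hT, hS, hB]
          rcases h01 j with h | h | h <;> rw [h] <;> norm_num
      have hle := hlen.le_card hmin hli hsum
      have hcard : Fintype.card T + 2 ≤ Fintype.card ι := by
        have hsub : (Finset.univ.filter fun j => b.repr z j = 0) ⊆ Finset.univ \ {i, k} := by
          intro j hj
          have hj' := (Finset.mem_filter.1 hj).2
          simp only [Finset.mem_sdiff, Finset.mem_univ, Finset.mem_insert, Finset.mem_singleton,
            true_and, not_or]
          exact ⟨fun h => hi (h ▸ hj'), fun h => hk (h ▸ hj')⟩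
        have h1 := Finset.card_le_card hsub
        rw [Finset.card_univ_sdiff, Finset.card_pair hki.symm] at h1
        have h2 : Fintype.card T = (Finset.univ.filter fun j => b.repr z j = 0).card :=
          Fintype.card_subtype _
        have h3 : 2 ≤ Fintype.card ι := by
          rw [← Finset.card_pair hki.symm, ← Finset.card_univ]
          exact Finset.card_le_card (Finset.subset_univ _)
        omega
      rw [Fintype.card_option] at hle
      omega
    have hz' : z = b.repr z i • b i := by
      apply b.ext_elem
      intro j
      by_cases hj : j = i
      · subst hj; simp
      · simp [hother j hj, Ne.symm hj]
    rcases (h01 i).resolve_left hi with h | h <;> rw [h] at hz'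
    · left; simpa using hz'
    · right; simpa using hz'
  · right
    intro i
    obtain ⟨a, ha⟩ := hhalf i
    have ha0 : b.repr z i ≠ 0 := by
      rw [ha]
      intro h
      have h2 : (2 * a + 1 : ℝ) = 0 := by linarith
      have h3 : 2 * a + 1 = 0 := by exact_mod_cast h2
      omega
    obtain ⟨m, hm⟩ := hb.inv_coord_int hL hz ha0
    have hprod : (a + 1 / 2 : ℝ) * m = 1 := by
      rw [← ha, ← hm]; exact mul_inv_cancel₀ ha0
    have hprod2 : (2 * a + 1) * m = 2 := by
      have : ((2 * a + 1 : ℝ)) * m = 2 := by linarith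
      exact_mod_cast this
    -- The coordinate is half of an odd divisor of `2`.
    have hdvd : 2 * a + 1 ∣ 2 := ⟨m, hprod2.symm⟩
    have hle := Int.le_of_dvd (by norm_num) hdvd
    have hle' := Int.le_of_dvd (by norm_num) ((neg_dvd).2 hdvd)
    have : a = 0 ∨ a = -1 := by omega
    rcases this with h | h <;> subst h <;> rw [ha] <;> norm_num

end Frames

/-! ### Admissible families of sign vectors -/

/-- The sign `(-1) ^ a` of a residue `a` modulo `2`. -/
def parSign (a : ZMod 2) : ℤ := if a = 0 then 1 else -1

/-- Four vectors are scattered if each of them has a coordinate in which it differs from the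
three others (which then agree). -/
def IsScattered {ι : Type*} (x : Fin 4 → ι → ZMod 2) : Prop :=
  ∀ j, ∃ i, ∀ k, k ≠ j → x k i = x j i + 1

/-- The combinatorial properties of the family of sign vectors of the signed half sums of a half
frame which are minimal. For a scattered quadruple `x`, the coordinates with odd sum `∑ j, x j` are
those in which one member of `x` differs from the three others. -/
structure IsAdmissible {n : ℕ} (F : Finset (Fin n → ZMod 2)) : Prop where
  add_one_mem : ∀ x ∈ F, x + 1 ∈ F
  card_le : ∀ x : Fin 4 → Fin n → ZMod 2, (∀ j, x j ∈ F) → IsScattered x →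
    (Finset.univ.filter fun i => ∑ j, x j i = 1).card ≤ 4
  sum_eq_one : ∀ x : Fin 4 → Fin n → ZMod 2, (∀ j, x j ∈ F) → IsScattered x →
    ∀ z ∈ F, (∀ j, z ≠ x j ∧ z ≠ x j + 1) → ∑ i, (∑ j, x j i) * (z i + x 0 i) = 1

theorem ZMod.eq_zero_or_eq_one (a : ZMod 2) : a = 0 ∨ a = 1 := by
  revert a; decide

theorem parSign_eq_or (a : ZMod 2) : parSign a = 1 ∨ parSign a = -1 := by
  revert a; decide

theorem parSign_injective : Function.Injective parSign := by
  unfold Function.Injective; decide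

theorem parSign_add_one (a : ZMod 2) : parSign (a + 1) = -parSign a := by
  revert a; decide

theorem sum_eq_one_of_odd_one_out (u : Fin 4 → ZMod 2) (j : Fin 4)
    (h : ∀ k, k ≠ j → u k = u j + 1) : ∑ k, u k = 1 := by
  revert u j; decide

theorem sum_parSign_congr (u : Fin 4 → ZMod 2) :
    ∃ m : ℤ, ∑ k, parSign (u k) + (if ∑ k, u k = 0 then 2 else 0) - 2 = 4 * m := by
  refine ⟨(∑ k, parSign (u k) + (if ∑ k, u k = 0 then 2 else 0) - 2) / 4, ?_⟩
  revert u; decide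

/-- The relation between the coordinates `β` of a half sum with respect to the frame modified
along a scattered quadruple, and its coordinate `z` in the original frame at a place where the
`j`-th member of the quadruple is the odd one out. -/
theorem coord_of_modified_frame (β u : Fin 4 → ZMod 2) (j : Fin 4) (z : ZMod 2)
    (hu : ∀ k, k ≠ j → u k = u j + 1)
    (h : 2 * parSign z = ∑ k, parSign (β k) * parSign (u k)) :
    z = u j + 1 + β j + (if ∀ k, β k = β 0 then 0 else 1) ∧ ∑ k, β k = 0 := by
  have hu' : ∀ k, u k = if k = j then u j else u j + 1 := by
    intro k; split_ifs with hk
    · rw [hk]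
    · exact hu k hk
  have h2 : ∑ k, parSign (β k) * parSign (u k) =
      ∑ k, parSign (β k) * parSign (if k = j then u j else u j + 1) :=
    Finset.sum_congr rfl fun k _ => by rw [← hu' k]
  rw [h2] at h
  generalize u j = c at *
  clear hu hu' h2 u
  revert β j z c
  decide

theorem IsScattered.exists_injective {ι : Type*} {x : Fin 4 → ι → ZMod 2} (hx : IsScattered x) :
    ∃ f : Fin 4 → ι, Function.Injective f ∧ ∀ j k, k ≠ j → x k (f j) = x j (f j) + 1 := by
  choose f hf using hx
  refine ⟨f, fun j j' hjj => ?_, hf⟩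
  by_contra hne
  obtain ⟨k, hk, hk'⟩ : ∃ k, k ≠ j ∧ k ≠ j' :=
    (by decide : ∀ a b : Fin 4, ∃ k, k ≠ a ∧ k ≠ b) j j'
  have h1 := hf j k hk
  have h2 := hf j' k hk'
  have h3 := hf j j' (Ne.symm hne)
  rw [← hjj] at h2
  rw [h2, h3] at h1
  simp at h1

/-! ### Half sums and modified frames -/

section ModifiedFrame

variable {E : Type*} [NormedAddCommGroup E] [InnerProductSpace ℝ E] {n : ℕ}

/-- The half sum of the basis `b` with signs `(-1) ^ x i`. -/
noncomputable def halfSum (b : Module.Basis (Fin n) ℝ E) (x : Fin n → ZMod 2) : E :=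
  ∑ i, ((parSign (x i) : ℝ) / 2) • b i

theorem repr_halfSum (b : Module.Basis (Fin n) ℝ E) (x : Fin n → ZMod 2) (i : Fin n) :
    b.repr (halfSum b x) i = (parSign (x i) : ℝ) / 2 := by
  simp [halfSum, Finsupp.finsetSum_apply, Finsupp.single_apply]

theorem halfSum_injective (b : Module.Basis (Fin n) ℝ E) : Function.Injective (halfSum b) := by
  intro x y h
  funext i
  have := congrArg (fun v => b.repr v i) h
  simp only [repr_halfSum] at this
  apply parSign_injective
  have h2 : (parSign (x i) : ℝ) = parSign (y i) := by linarith
  exact_mod_cast h2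

theorem halfSum_add_one (b : Module.Basis (Fin n) ℝ E) (x : Fin n → ZMod 2) :
    halfSum b (x + 1) = -halfSum b x := by
  apply b.ext_elem
  intro i
  rw [repr_halfSum, map_neg, Finsupp.neg_apply, repr_halfSum, Pi.add_apply, Pi.one_apply,
    parSign_add_one]
  push_cast; ring

theorem halfSum_ne_basis (b : Module.Basis (Fin n) ℝ E) (x : Fin n → ZMod 2) (i : Fin n) :
    halfSum b x ≠ b i ∧ halfSum b x ≠ -b i := by
  constructor <;> intro h <;>
  · have := congrArg (fun v => b.repr v i) h
    simp only [repr_halfSum, map_neg, Finsupp.neg_apply, Module.Basis.repr_self,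
      Finsupp.single_eq_same] at this
    rcases parSign_eq_or (x i) with h | h <;> rw [h] at this <;> norm_num at this

theorem exists_halfSum_eq (b : Module.Basis (Fin n) ℝ E) {z : E}
    (hz : ∀ i, b.repr z i = 1 / 2 ∨ b.repr z i = -(1 / 2)) : ∃ x, halfSum b x = z := by
  classical
  refine ⟨fun i => if b.repr z i = 1 / 2 then 0 else 1, b.ext_elem fun i => ?_⟩
  rw [repr_halfSum]
  rcases hz i with h | h <;> rw [h] <;> norm_num [parSign]

/-- The family obtained from the frame `b` by replacing the frame vectors at the odd places of a
quadruple `x` by the four half sums. -/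
noncomputable def modifiedFrame (b : Module.Basis (Fin n) ℝ E) (x : Fin 4 → Fin n → ZMod 2) :
    Fin 4 ⊕ {i : Fin n // ∑ j, x j i = 0} → E :=
  Sum.elim (fun j => halfSum b (x j)) fun t => b t

/-- At an odd place of the quadruple, only the four half sums contribute. -/
theorem repr_sum_modifiedFrame (b : Module.Basis (Fin n) ℝ E) (x : Fin 4 → Fin n → ZMod 2)
    (g : Fin 4 ⊕ {i : Fin n // ∑ j, x j i = 0} → ℝ) {i : Fin n} (hi : ∑ j, x j i = 1) :
    b.repr (∑ o, g o • modifiedFrame b x o) i =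
      ∑ j, g (Sum.inl j) * ((parSign (x j i) : ℝ) / 2) := by
  rw [Fintype.sum_sum_type, map_add, Finsupp.add_apply, map_sum, map_sum,
    Finsupp.finsetSum_apply, Finsupp.finsetSum_apply]
  have h : ∀ t : {i : Fin n // ∑ j, x j i = 0}, (t : Fin n) ≠ i := by
    rintro t rfl
    rw [t.2] at hi
    exact zero_ne_one hi
  simp [modifiedFrame, repr_halfSum, h]

/-- If the coefficients of the half sums in a relation are `g k`, then the place at which the `j`-th
half sum is the odd one out gives `∑ k, g k = 2 g j`. So all `g j` agree, and
`4 g j = 2 g j`. -/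
theorem linearIndependent_modifiedFrame (b : Module.Basis (Fin n) ℝ E)
    {x : Fin 4 → Fin n → ZMod 2} (hx : IsScattered x) :
    LinearIndependent ℝ (modifiedFrame b x) := by
  rw [Fintype.linearIndependent_iff]
  intro g hg
  have hj : ∀ j, ∑ k, g (Sum.inl k) = 2 * g (Sum.inl j) := by
    intro j
    obtain ⟨i, hi⟩ := hx j
    have h := repr_sum_modifiedFrame b x g
      (sum_eq_one_of_odd_one_out (fun k => x k i) j hi)
    rw [hg, map_zero, Finsupp.zero_apply] at h
    have hsign : ∀ k, (parSign (x k i) : ℝ) = parSign (x j i) * ((if k = j then 2 else 0) - 1) := by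
      intro k
      split_ifs with hk
      · rw [hk]; ring
      · rw [hi k hk, parSign_add_one]; push_cast; ring
    have h2 : (∑ k, g (Sum.inl k) * ((parSign (x k i) : ℝ) / 2)) =
        (parSign (x j i) : ℝ) / 2 * (2 * g (Sum.inl j) - ∑ k, g (Sum.inl k)) := by
      have hterm : ∀ k, g (Sum.inl k) * ((parSign (x k i) : ℝ) / 2) =
          (parSign (x j i) : ℝ) / 2 *
            ((if k = j then 2 * g (Sum.inl j) else 0) - g (Sum.inl k)) := by
        intro k
        rw [hsign k]
        split_ifs with hk
        · rw [hk]; ring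
        · ring
      rw [Finset.sum_congr rfl fun k _ => hterm k, ← Finset.mul_sum, Finset.sum_sub_distrib,
        Finset.sum_ite_eq', if_pos (Finset.mem_univ _)]
    rw [h2] at h
    have h3 : (parSign (x j i) : ℝ) / 2 ≠ 0 := by
      rcases parSign_eq_or (x j i) with h | h <;> rw [h] <;> norm_num
    have := (mul_eq_zero.1 h.symm).resolve_left h3
    linarith
  have h0 : ∀ j, g (Sum.inl j) = 0 := by
    have h0 := hj 0
    have h1 := hj 1
    have h2 := hj 2
    have h3 := hj 3
    rw [Fin.sum_univ_four] at h0 h1 h2 h3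
    intro j
    fin_cases j <;> simp only [Fin.zero_eta, Fin.mk_one, Fin.reduceFinMk] <;> linarith
  rw [Fintype.sum_sum_type] at hg
  simp only [h0, zero_smul, Finset.sum_const_zero, zero_add] at hg
  have h2 := Fintype.linearIndependent_iff.1
    (b.linearIndependent.comp (Subtype.val : {i : Fin n // ∑ j, x j i = 0} → Fin n)
      Subtype.val_injective) (fun t => g (Sum.inr t)) hg
  rintro (j | t)
  · exact h0 j
  · exact h2 t

/-- The sum has odd coordinates at every place, as has `∑ b`, so the two agree modulo `2L`. -/
theorem sum_modifiedFrame {L : Submodule ℤ E} {b : Module.Basis (Fin n) ℝ E}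
    (hb : IsHalfFrame L b) (x : Fin 4 → Fin n → ZMod 2) :
    ∃ y ∈ L, ∑ o, modifiedFrame b x o = (2 : ℤ) • y := by
  obtain ⟨y, hy, hyb⟩ := hb.2
  choose m hm using fun i => sum_parSign_congr fun k => x k i
  refine ⟨y + ∑ i, m i • b i, L.add_mem hy (L.sum_mem fun i _ => L.smul_mem _ (hb.1 i).1), ?_⟩
  rw [smul_add, ← hyb, Fintype.sum_sum_type]
  apply b.ext_elem
  intro i
  have hT : (∑ t : {i : Fin n // ∑ j, x j i = 0}, b.repr (b t) i) =
      if ∑ j, x j i = 0 then 1 else 0 := by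
    split_ifs with h
    · rw [Finset.sum_eq_single (⟨i, h⟩ : {i : Fin n // ∑ j, x j i = 0})]
      · simp
      · intro t _ ht
        have : (t : Fin n) ≠ i := fun h' => ht (Subtype.ext h')
        simp [this]
      · simp
    · refine Finset.sum_eq_zero fun t _ => ?_
      have : (t : Fin n) ≠ i := fun h' => h (h' ▸ t.2)
      simp [this]
  have hB : (∑ k, b.repr (b k) i) = 1 := by
    simp [Finsupp.single_apply]
  have hM : (∑ k, b.repr (m k • b k) i) = m i := by
    simp [Finsupp.single_apply]
  have hdiv := congrArg (Int.cast : ℤ → ℝ) (hm i)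
  push_cast at hdiv
  simp only [modifiedFrame, Sum.elim_inl, Sum.elim_inr, map_add, map_sum, map_zsmul,
    Finsupp.add_apply, Finsupp.finsetSum_apply, Finsupp.smul_apply, repr_halfSum]
  simp only [map_zsmul, Finsupp.smul_apply] at hM
  rw [hT, hB, hM, ← Finset.sum_div]
  split_ifs at hdiv ⊢ <;> simp only [zsmul_eq_mul] <;> push_cast at hdiv ⊢ <;> linarith

end ModifiedFrame

/-! ### The sign vectors form an admissible family -/

theorem IsScattered.four_le_card {n : ℕ} {x : Fin 4 → Fin n → ZMod 2} (hx : IsScattered x) :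
    4 ≤ (Finset.univ.filter fun i => ∑ j, x j i = 1).card := by
  obtain ⟨f, hinj, hf⟩ := hx.exists_injective
  have h4 : (Finset.univ.image f).card = 4 := by
    rw [Finset.card_image_of_injective _ hinj, Finset.card_univ, Fintype.card_fin]
  refine h4.symm.le.trans (Finset.card_le_card fun i hi => ?_)
  obtain ⟨j, -, rfl⟩ := Finset.mem_image.1 hi
  exact Finset.mem_filter.2
    ⟨Finset.mem_univ _, sum_eq_one_of_odd_one_out (fun k => x k (f j)) j (hf j)⟩

theorem card_odd_add_card_even {n : ℕ} (x : Fin 4 → Fin n → ZMod 2) :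
    (Finset.univ.filter fun i => ∑ j, x j i = 1).card +
      Fintype.card {i : Fin n // ∑ j, x j i = 0} = n := by
  rw [Fintype.card_subtype]
  have h := Finset.card_filter_add_card_filter_not (s := (Finset.univ : Finset (Fin n)))
    (fun i => ∑ j, x j i = 1)
  rw [Finset.card_univ, Fintype.card_fin] at h
  have h2 : ∀ i, ¬ (∑ j, x j i = 1) ↔ ∑ j, x j i = 0 := by
    intro i
    generalize ∑ j, x j i = a
    revert a; decide
  simp_rw [h2] at h
  exact h

section SignVectors

variable {E : Type*} [NormedAddCommGroup E] [InnerProductSpace ℝ E] {n : ℕ}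
  {L : Submodule ℤ E}

theorem modifiedFrame_mem {b : Module.Basis (Fin n) ℝ E}
    (hb : IsHalfFrame L b) {x : Fin 4 → Fin n → ZMod 2}
    (hx : ∀ j, halfSum b (x j) ∈ minimalVectors L) (o) :
    modifiedFrame b x o ∈ minimalVectors L := by
  rcases o with j | t
  · exact hx j
  · exact hb.1 t

/-- The modified frame has `4` more members than there are even places, and is not shorter than the
length `n`. -/
theorem card_odd_le_four (hlen : HasLength L n) {b : Module.Basis (Fin n) ℝ E}
    (hb : IsHalfFrame L b) {x : Fin 4 → Fin n → ZMod 2}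
    (hx : ∀ j, halfSum b (x j) ∈ minimalVectors L) (hs : IsScattered x) :
    (Finset.univ.filter fun i => ∑ j, x j i = 1).card ≤ 4 := by
  have h := hlen.le_card (modifiedFrame_mem hb hx) (linearIndependent_modifiedFrame b hs)
    (sum_modifiedFrame hb x)
  rw [Fintype.card_sum, Fintype.card_fin] at h
  have := card_odd_add_card_even x
  omega

/-- The sign vectors of the minimal half sums of a half frame. -/
noncomputable def signVectors (L : Submodule ℤ E) (b : Module.Basis (Fin n) ℝ E) :
    Finset (Fin n → ZMod 2) :=
  open Classical in Finset.univ.filter fun x => halfSum b x ∈ minimalVectors L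

theorem mem_signVectors {b : Module.Basis (Fin n) ℝ E} {x : Fin n → ZMod 2} :
    x ∈ signVectors L b ↔ halfSum b x ∈ minimalVectors L := by
  simp [signVectors]

/-- A set of vectors that realises the length `n = dim E` is a half frame. -/
theorem exists_isHalfFrame (hn : Module.finrank ℝ E = n) (hlen : HasLength L n) :
    ∃ b : Module.Basis (Fin n) ℝ E, IsHalfFrame L b := by
  obtain ⟨X, hne, hX, hli, ⟨y, hy, hsum⟩, hcard⟩ := hlen.1
  have hcard' : Fintype.card X = n := by rw [Fintype.card_coe, hcard]
  have : Nonempty X := hne.to_subtype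
  let b₀ := basisOfLinearIndependentOfCardEqFinrank hli (hcard'.trans hn.symm)
  have hb₀ : ∀ t, b₀ t = (t : E) := fun t => by simp [b₀]
  let e := Fintype.equivFinOfCardEq hcard'
  refine ⟨b₀.reindex e, fun i => ?_, y, hy, ?_⟩
  · rw [Module.Basis.reindex_apply, hb₀]
    exact hX _ (Subtype.coe_prop _)
  · simp_rw [Module.Basis.reindex_apply, hb₀]
    rw [e.symm.sum_comp (fun t : X => (t : E)), Finset.sum_coe_sort X (fun t => t), hsum]

variable [FiniteDimensional ℝ E] [DiscreteTopology L] [IsZLattice ℝ L]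

/-- The modified frame is again a half frame, so every further minimal half sum is a half sum of
the modified frame too; this determines its parity on the odd places of the quadruple. -/
theorem sum_odd_eq_one (hL : HasMaximalIndex L 2) (hlen : HasLength L n)
    {b : Module.Basis (Fin n) ℝ E} (hb : IsHalfFrame L b) {x : Fin 4 → Fin n → ZMod 2}
    (hx : ∀ j, halfSum b (x j) ∈ minimalVectors L) (hs : IsScattered x) {z : Fin n → ZMod 2}
    (hz : halfSum b z ∈ minimalVectors L) (hzx : ∀ j, z ≠ x j ∧ z ≠ x j + 1) :
    ∑ i, (∑ j, x j i) * (z i + x 0 i) = 1 := by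
  classical
  have hK := card_odd_le_four hlen hb hx hs
  have hcard := card_odd_add_card_even x
  have hK4 : (Finset.univ.filter fun i => ∑ j, x j i = 1).card = 4 :=
    le_antisymm hK hs.four_le_card
  have hn : Module.finrank ℝ E = n := by
    rw [Module.finrank_eq_card_basis b, Fintype.card_fin]
  have hcard' : Fintype.card (Fin 4 ⊕ {i : Fin n // ∑ j, x j i = 0}) = n := by
    rw [Fintype.card_sum, Fintype.card_fin]; omega
  let b' := basisOfLinearIndependentOfCardEqFinrank (linearIndependent_modifiedFrame b hs)
    (hcard'.trans hn.symm)
  have hb'v : ⇑b' = modifiedFrame b x := coe_basisOfLinearIndependentOfCardEqFinrank _ _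
  have hb' : IsHalfFrame L b' := by
    constructor
    · rw [hb'v]; exact modifiedFrame_mem hb hx
    · rw [hb'v]; exact sum_modifiedFrame hb x
  have hcases := hb'.minimal_cases hL (hcard'.symm ▸ hlen) hz
  have hhalf : ∀ o, b'.repr (halfSum b z) o = 1 / 2 ∨ b'.repr (halfSum b z) o = -(1 / 2) := by
    refine hcases.resolve_left ?_
    rintro ⟨j | t, ho⟩ <;> rw [hb'v] at ho <;>
      simp only [modifiedFrame, Sum.elim_inl, Sum.elim_inr] at ho
    · rcases ho with ho | ho
      · exact (hzx j).1 (halfSum_injective b ho)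
      · rw [← halfSum_add_one] at ho
        exact (hzx j).2 (halfSum_injective b ho)
    · have h := halfSum_ne_basis b z t
      exact ho.elim h.1 h.2
  have hβ : ∀ o, ∃ β : ZMod 2, b'.repr (halfSum b z) o = (parSign β : ℝ) / 2 := by
    intro o
    rcases hhalf o with h | h
    · exact ⟨0, by rw [h]; norm_num [parSign]⟩
    · exact ⟨1, by rw [h]; norm_num [parSign]⟩
  choose β hβ using hβ
  obtain ⟨f, hinj, hf⟩ := hs.exists_injective
  have hodd : ∀ j, ∑ k, x k (f j) = 1 := fun j =>
    sum_eq_one_of_odd_one_out (fun k => x k (f j)) j (hf j)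
  have hcoord : ∀ j, 2 * parSign (z (f j)) =
      ∑ k, parSign (β (Sum.inl k)) * parSign (x k (f j)) := by
    intro j
    have h := repr_sum_modifiedFrame b x (b'.repr (halfSum b z)) (hodd j)
    rw [← hb'v, b'.sum_repr, repr_halfSum] at h
    simp_rw [hβ] at h
    have h2 : (2 * parSign (z (f j)) : ℝ) =
        ∑ k, (parSign (β (Sum.inl k)) : ℝ) * parSign (x k (f j)) := by
      have h3 := congrArg (fun r : ℝ => 4 * r) h
      simp only [Finset.mul_sum] at h3
      calc (2 * parSign (z (f j)) : ℝ) = 4 * ((parSign (z (f j)) : ℝ) / 2) := by ring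
        _ = _ := h3
        _ = _ := Finset.sum_congr rfl fun k _ => by ring
    exact_mod_cast h2
  have hkey := fun j => coord_of_modified_frame (fun k => β (Sum.inl k)) (fun k => x k (f j)) j
    (z (f j)) (hf j) (hcoord j)
  have hβsum : ∑ k, β (Sum.inl k) = 0 := (hkey 0).2
  have hfilter : (Finset.univ.filter fun i => ∑ j, x j i = 1) = Finset.univ.image f := by
    symm
    refine Finset.eq_of_subset_of_card_le (fun i hi => ?_) ?_
    · obtain ⟨j, -, rfl⟩ := Finset.mem_image.1 hi
      exact Finset.mem_filter.2 ⟨Finset.mem_univ _, hodd j⟩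
    · rw [Finset.card_image_of_injective _ hinj, hK4, Finset.card_univ, Fintype.card_fin]
  have hsum : ∑ i, (∑ j, x j i) * (z i + x 0 i) = ∑ j, (z (f j) + x 0 (f j)) := by
    rw [← Finset.sum_image (g := f) (f := fun i => z i + x 0 i) hinj.injOn, ← hfilter,
      Finset.sum_filter]
    refine Finset.sum_congr rfl fun i _ => ?_
    rcases ZMod.eq_zero_or_eq_one (∑ j, x j i) with h | h <;> rw [h] <;> simp
  have hterm : ∀ j, z (f j) + x 0 (f j) = β (Sum.inl j) +
      ((if ∀ k, β (Sum.inl k) = β (Sum.inl 0) then 0 else 1) + if j = 0 then 1 else 0) := by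
    intro j
    rw [(hkey j).1]
    have hx0 : x 0 (f j) = x j (f j) + 1 + if j = 0 then 1 else 0 := by
      split_ifs with h
      · rw [h, add_assoc, CharTwo.add_self_eq_zero, add_zero]
      · rw [hf j 0 (Ne.symm h), add_zero]
    rw [hx0]
    generalize x j (f j) + 1 = c
    linear_combination CharTwo.add_self_eq_zero c
  rw [hsum, Finset.sum_congr rfl fun j _ => hterm j, Finset.sum_add_distrib, hβsum]
  generalize (if ∀ k, β (Sum.inl k) = β (Sum.inl 0) then (0 : ZMod 2) else 1) = c
  revert c; decide

theorem isAdmissible_signVectors (hL : HasMaximalIndex L 2) (hlen : HasLength L n)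
    {b : Module.Basis (Fin n) ℝ E} (hb : IsHalfFrame L b) :
    IsAdmissible (signVectors L b) := by
  refine ⟨fun x hx => ?_, fun x hx hs => ?_, fun x hx hs z hz hzx => ?_⟩
  · rw [mem_signVectors, halfSum_add_one]
    exact neg_mem_minimalVectors (mem_signVectors.1 hx)
  · exact card_odd_le_four hlen hb (fun j => mem_signVectors.1 (hx j)) hs
  · exact sum_odd_eq_one hL hlen hb (fun j => mem_signVectors.1 (hx j)) hs
      (mem_signVectors.1 hz) hzx

theorem halfKissingNumber_le (hL : HasMaximalIndex L 2) (hlen : HasLength L n) (hn : n ≠ 0)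
    {b : Module.Basis (Fin n) ℝ E} (hb : IsHalfFrame L b) :
    halfKissingNumber L ≤ n + ((signVectors L b).card : ℝ) / 2 := by
  classical
  have : Nonempty (Fin n) := ⟨⟨0, Nat.pos_of_ne_zero hn⟩⟩
  let S : Finset E := Finset.univ.image b ∪ Finset.univ.image (fun i => -b i) ∪
    (signVectors L b).image (halfSum b)
  have hsub : minimalVectors L ⊆ (S : Set E) := by
    intro z hz
    have hlen' : HasLength L (Fintype.card (Fin n)) := by rwa [Fintype.card_fin]
    rw [Finset.mem_coe]
    rcases hb.minimal_cases hL hlen' hz with ⟨i, rfl | rfl⟩ | h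
    · exact Finset.mem_union_left _ (Finset.mem_union_left _ (Finset.mem_image_of_mem _
        (Finset.mem_univ _)))
    · exact Finset.mem_union_left _ (Finset.mem_union_right _
        (Finset.mem_image_of_mem (fun i => -b i) (Finset.mem_univ _)))
    · obtain ⟨x, rfl⟩ := exists_halfSum_eq b h
      exact Finset.mem_union_right _ (Finset.mem_image_of_mem _ (mem_signVectors.2 hz))
  have h1 : (minimalVectors L).ncard ≤ S.card := by
    rw [← Set.ncard_coe_finset]
    exact Set.ncard_le_ncard hsub S.finite_toSet
  have h2 : S.card ≤ n + n + (signVectors L b).card := by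
    refine (Finset.card_union_le _ _).trans (add_le_add ((Finset.card_union_le _ _).trans
      (add_le_add ?_ ?_)) Finset.card_image_le) <;>
    exact Finset.card_image_le.trans (by simp)
  have h3 : ((minimalVectors L).ncard : ℝ) ≤ n + n + (signVectors L b).card := by
    exact_mod_cast h1.trans h2
  unfold halfKissingNumber
  linarith

end SignVectors

/-! ### Contraction of admissible families -/

theorem signVector_add_self {n : ℕ} (x : Fin n → ZMod 2) : x + x = 0 :=
  funext fun i => CharTwo.add_self_eq_zero (x i)

/-- The family obtained by deleting the `i`-th coordinate. -/
def contraction {n : ℕ} (i : Fin (n + 1)) (F : Finset (Fin (n + 1) → ZMod 2)) :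
    Finset (Fin n → ZMod 2) :=
  F.image fun x k => x (i.succAbove k)

/-- The members of `F` which remain in `F` when their `i`-th coordinate is flipped. -/
def flippable {n : ℕ} (i : Fin n) (F : Finset (Fin n → ZMod 2)) : Finset (Fin n → ZMod 2) :=
  F.filter fun x => x + Pi.single i 1 ∈ F

theorem IsAdmissible.contraction {n : ℕ} {F : Finset (Fin (n + 1) → ZMod 2)}
    (hF : IsAdmissible F) (i : Fin (n + 1)) : IsAdmissible (contraction i F) := by
  have hlift : ∀ x : Fin 4 → Fin n → ZMod 2, (∀ j, x j ∈ _root_.contraction i F) →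
      ∃ X : Fin 4 → Fin (n + 1) → ZMod 2, (∀ j, X j ∈ F) ∧
        ∀ j k, X j (i.succAbove k) = x j k := by
    intro x hx
    choose X hX hXx using fun j => Finset.mem_image.1 (hx j)
    exact ⟨X, hX, fun j k => congrFun (hXx j) k⟩
  have hscat : ∀ (x : Fin 4 → Fin n → ZMod 2) (X : Fin 4 → Fin (n + 1) → ZMod 2),
      (∀ j k, X j (i.succAbove k) = x j k) → IsScattered x → IsScattered X := by
    intro x X hXx hx j
    obtain ⟨k, hk⟩ := hx j
    exact ⟨i.succAbove k, fun l hl => by rw [hXx, hXx, hk l hl]⟩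
  have himage : ∀ (x : Fin 4 → Fin n → ZMod 2) (X : Fin 4 → Fin (n + 1) → ZMod 2),
      (∀ j k, X j (i.succAbove k) = x j k) →
      (Finset.univ.filter fun k => ∑ j, x j k = 1).image i.succAbove ⊆
        Finset.univ.filter fun k => ∑ j, X j k = 1 := by
    intro x X hXx k hk
    obtain ⟨l, hl, rfl⟩ := Finset.mem_image.1 hk
    refine Finset.mem_filter.2 ⟨Finset.mem_univ _, ?_⟩
    simp_rw [hXx]
    exact (Finset.mem_filter.1 hl).2
  refine ⟨fun x hx => ?_, fun x hx hs => ?_, fun x hx hs z hz hzx => ?_⟩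
  · obtain ⟨X, hX, rfl⟩ := Finset.mem_image.1 hx
    exact Finset.mem_image.2 ⟨X + 1, hF.add_one_mem X hX, rfl⟩
  · obtain ⟨X, hX, hXx⟩ := hlift x hx
    have h := Finset.card_le_card (himage x X hXx)
    rw [Finset.card_image_of_injective _ Fin.succAbove_right_injective] at h
    exact h.trans (hF.card_le X hX (hscat x X hXx hs))
  · obtain ⟨X, hX, hXx⟩ := hlift x hx
    obtain ⟨Z, hZ, rfl⟩ := Finset.mem_image.1 hz
    have hne : ∀ j, Z ≠ X j ∧ Z ≠ X j + 1 := by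
      refine fun j => ⟨fun h => (hzx j).1 ?_, fun h => (hzx j).2 ?_⟩ <;> funext k <;>
        simp only [h, Pi.add_apply, Pi.one_apply, hXx]
    have hsX := hscat x X hXx hs
    have h := hF.sum_eq_one X hX hsX Z hZ hne
    -- The deleted place is not an odd place of the lifted quadruple: that would be a fifth one.
    have hi : ∑ j, X j i = 0 := by
      refine (ZMod.eq_zero_or_eq_one _).resolve_right fun h1 => ?_
      have hsub : insert i ((Finset.univ.filter fun k => ∑ j, x j k = 1).image i.succAbove) ⊆
          Finset.univ.filter fun k => ∑ j, X j k = 1 :=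
        Finset.insert_subset (Finset.mem_filter.2 ⟨Finset.mem_univ _, h1⟩) (himage x X hXx)
      have h2 := Finset.card_le_card hsub
      rw [Finset.card_insert_of_notMem (by simp [Fin.succAbove_ne]),
        Finset.card_image_of_injective _ Fin.succAbove_right_injective] at h2
      have h3 := hF.card_le X hX hsX
      have h4 := hs.four_le_card
      omega
    rw [Fin.sum_univ_succAbove _ i, hi, zero_mul, zero_add] at h
    simpa only [hXx] using h

/-- The fibres of the deletion of the `i`-th coordinate are singletons, or pairs of flippable
vectors. -/
theorem card_le_card_contraction {n : ℕ} (F : Finset (Fin (n + 1) → ZMod 2)) (i : Fin (n + 1)) :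
    2 * F.card ≤ 2 * (contraction i F).card + (flippable i F).card := by
  let r : (Fin (n + 1) → ZMod 2) → Fin n → ZMod 2 := fun x k => x (i.succAbove k)
  have hr : ∀ x x', r x' = r x → x' = x ∨ x' = x + Pi.single i 1 := by
    intro x x' h
    have h' : ∀ k, x' (i.succAbove k) = x (i.succAbove k) := fun k => congrFun h k
    have hi : x' i = x i ∨ x' i = x i + 1 :=
      (by decide : ∀ a b : ZMod 2, a = b ∨ a = b + 1) _ _
    refine hi.imp (fun hi => ?_) fun hi => ?_ <;> funext k <;>
      rcases Fin.eq_self_or_eq_succAbove i k with rfl | ⟨l, rfl⟩ <;> simp [hi, h']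
  have h1 : F.card = ∑ y ∈ contraction i F, (F.filter fun x => r x = y).card :=
    Finset.card_eq_sum_card_image r F
  have h2 : (flippable i F).card =
      ∑ y ∈ contraction i F, ((flippable i F).filter fun x => r x = y).card :=
    Finset.card_eq_sum_card_fiberwise fun x hx =>
      Finset.mem_image_of_mem r (Finset.mem_filter.1 hx).1
  rw [h1, h2, Finset.mul_sum, mul_comm 2, ← smul_eq_mul, ← Finset.sum_const,
    ← Finset.sum_add_distrib]
  refine Finset.sum_le_sum fun y hy => ?_
  obtain ⟨x, hx, rfl⟩ := Finset.mem_image.1 hy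
  change 2 * (F.filter fun x' => r x' = r x).card ≤
    2 + ((flippable i F).filter fun x' => r x' = r x).card
  have hne : x ≠ x + Pi.single i 1 := by
    intro h
    have := congrFun h i
    simp at this
  by_cases hflip : x + Pi.single i 1 ∈ F
  · have hle : (F.filter fun x' => r x' = r x).card ≤ 2 := by
      refine (Finset.card_le_card (t := {x, x + Pi.single i 1}) fun x' hx' => ?_).trans
        (Finset.card_pair hne).le
      rcases hr x x' (Finset.mem_filter.1 hx').2 with h | h <;> simp [h]
    have hge : 2 ≤ ((flippable i F).filter fun x' => r x' = r x).card := by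
      refine (Finset.card_pair hne).ge.trans (Finset.card_le_card fun x' hx' => ?_)
      rw [Finset.mem_insert, Finset.mem_singleton] at hx'
      rcases hx' with rfl | rfl
      · simp [flippable, hx, hflip]
      · have h2 : x + Pi.single i 1 + Pi.single i 1 = x := by
          rw [add_assoc, signVector_add_self, add_zero]
        simp [flippable, hflip, h2, hx, r]
    omega
  · have hle : (F.filter fun x' => r x' = r x).card ≤ 1 := by
      refine (Finset.card_le_card (t := {x}) fun x' hx' => ?_).trans (Finset.card_singleton x).le
      rw [Finset.mem_filter] at hx'
      rcases hr x x' hx'.2 with h | h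
      · simp [h]
      · exact absurd (h ▸ hx'.1) hflip
    have : 2 * (F.filter fun x' => r x' = r x).card ≤ 2 := by omega
    exact this.trans (Nat.le_add_right _ _)

/-! ### Stars -/

section Star

variable {n : ℕ} {F : Finset (Fin n → ZMod 2)} {x : Fin n → ZMod 2} {p : Fin 4 → Fin n}

theorem isScattered_star (x : Fin n → ZMod 2) (hp : Function.Injective p) :
    IsScattered fun j => x + Pi.single (p j) 1 := by
  intro j
  refine ⟨p j, fun k hk => ?_⟩
  have : p j ≠ p k := fun h => hk (hp h).symm
  simp only [Pi.add_apply, Pi.single_eq_same, Pi.single_eq_of_ne this, add_zero, add_assoc]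
  rw [CharTwo.add_self_eq_zero, add_zero]

/-- If `x + e` lies in `F` for four unit vectors `e`, then every other member of `F` differs
from `x` in an even number of the four corresponding places. -/
theorem IsAdmissible.star_parity (hF : IsAdmissible F) (hp : Function.Injective p)
    (hx : ∀ j, x + Pi.single (p j) 1 ∈ F) {z : Fin n → ZMod 2} (hz : z ∈ F)
    (hzx : ∀ j, z ≠ x + Pi.single (p j) 1 ∧ z ≠ x + Pi.single (p j) 1 + 1) :
    ∑ j, (z (p j) + x (p j)) = 0 := by
  have h := hF.sum_eq_one _ hx (isScattered_star x hp) z hz hzx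
  have hs : ∀ i, ∑ j, (x + Pi.single (p j) 1 : Fin n → ZMod 2) i =
      ∑ j, (Pi.single (p j) 1 : Fin n → ZMod 2) i := by
    intro i
    simp only [Pi.add_apply, Finset.sum_add_distrib, Finset.sum_const, Finset.card_univ,
      Fintype.card_fin, nsmul_eq_mul]
    rw [(by decide : ((4 : ℕ) : ZMod 2) = 0), zero_mul, zero_add]
  simp_rw [hs, Finset.sum_mul] at h
  rw [Finset.sum_comm] at h
  simp only [Pi.single_apply, ite_mul, one_mul, zero_mul, Finset.sum_ite_eq',
    Finset.mem_univ, if_true, Pi.add_apply, hp.eq_iff, ← add_assoc] at h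
  rw [Finset.sum_add_distrib, Finset.sum_ite_eq' Finset.univ (0 : Fin 4) fun _ => (1 : ZMod 2),
    if_pos (Finset.mem_univ _)] at h
  simpa using h

/-- By `IsAdmissible.star_parity`, of two members of `F` that differ just in a direction of the star
one is a leaf or the complement of a leaf. Of these eight vectors, two are not flippable if
`hbad` holds, which leaves at most six pairs. -/
theorem IsAdmissible.card_flippable_le (hF : IsAdmissible F) (hp : Function.Injective p)
    (hx : ∀ j, x + Pi.single (p j) 1 ∈ F) (a : Fin 4)
    (hbad : ∃ j, x + Pi.single (p j) 1 + Pi.single (p a) 1 ∉ F) :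
    (flippable (p a) F).card ≤ 12 := by
  obtain ⟨b, hb⟩ := hbad
  let q : Fin 4 → Fin n → ZMod 2 := fun j => x + Pi.single (p j) 1
  -- The leaves, other than the `b`-th one, and their complements.
  let Q : Finset (Fin n → ZMod 2) :=
    (Finset.univ.erase b).image q ∪ (Finset.univ.erase b).image fun j => q j + 1
  have hQ : Q.card ≤ 6 := by
    refine (Finset.card_union_le _ _).trans ?_
    have h3 : (Finset.univ.erase b).card = 3 := by
      rw [Finset.card_erase_of_mem (Finset.mem_univ b), Finset.card_univ, Fintype.card_fin]
    have h1 : ((Finset.univ.erase b).image q).card ≤ 3 := h3 ▸ Finset.card_image_le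
    have h2 : ((Finset.univ.erase b).image fun j => q j + 1).card ≤ 3 := h3 ▸ Finset.card_image_le
    omega
  have hodd : ∀ z ∈ F, z + Pi.single (p a) 1 ∈ F → ∑ j, (z (p j) + x (p j)) = 1 → z ∈ Q := by
    intro z hz hz' hsum
    by_contra hzQ
    have hne : ∀ j, z ≠ q j ∧ z ≠ q j + 1 := by
      intro j
      by_cases hj : j = b
      · subst hj
        refine ⟨fun h => hb (by rwa [h] at hz'), fun h => hb ?_⟩
        have h2 := hF.add_one_mem _ hz'
        rw [h] at h2
        have h3 : q j + 1 + Pi.single (p a) 1 + 1 = q j + Pi.single (p a) 1 := by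
          linear_combination signVector_add_self (1 : Fin n → ZMod 2)
        rwa [h3] at h2
      · have hj' : j ∈ Finset.univ.erase b := Finset.mem_erase.2 ⟨hj, Finset.mem_univ _⟩
        exact ⟨fun h => hzQ (Finset.mem_union_left _ (Finset.mem_image.2 ⟨j, hj', h.symm⟩)),
          fun h => hzQ (Finset.mem_union_right _ (Finset.mem_image.2 ⟨j, hj', h.symm⟩))⟩
    have := hF.star_parity hp hx hz hne
    rw [this] at hsum
    exact zero_ne_one hsum
  have hself : ∀ z : Fin n → ZMod 2, z + Pi.single (p a) 1 + Pi.single (p a) 1 = z := by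
    intro z
    rw [add_assoc, signVector_add_self, add_zero]
  have hsub : flippable (p a) F ⊆ Q ∪ Q.image fun z => z + Pi.single (p a) 1 := by
    intro z hz
    obtain ⟨hzF, hz'⟩ := Finset.mem_filter.1 hz
    rcases ZMod.eq_zero_or_eq_one (∑ j, (z (p j) + x (p j))) with h | h
    · refine Finset.mem_union_right _ (Finset.mem_image.2 ⟨z + Pi.single (p a) 1, ?_, hself z⟩)
      refine hodd _ hz' (by rwa [hself]) ?_
      have : ∀ j, (z + Pi.single (p a) 1 : Fin n → ZMod 2) (p j) + x (p j) =
          (z (p j) + x (p j)) + if j = a then 1 else 0 := by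
        intro j
        simp only [Pi.add_apply, Pi.single_apply, hp.eq_iff]
        ring
      simp_rw [this]
      rw [Finset.sum_add_distrib, h, Finset.sum_ite_eq', if_pos (Finset.mem_univ _), zero_add]
    · exact Finset.mem_union_left _ (hodd z hzF hz' h)
  have h1 := (Finset.card_le_card hsub).trans (Finset.card_union_le _ _)
  have h2 : (Q.image fun z => z + Pi.single (p a) 1).card ≤ Q.card := Finset.card_image_le
  omega

/-- A member of `F` with four neighbours in `F` yields a direction in which few members of `F`
can be flipped: if the first two directions of the star both had many flippable members, then one
of the leaves would carry a second star, and a member of `F` would violate its parity condition. -/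
theorem IsAdmissible.exists_card_flippable_le (hF : IsAdmissible F) (hn : 5 ≤ n)
    (hp : Function.Injective p) (hx : ∀ j, x + Pi.single (p j) 1 ∈ F) :
    ∃ i, (flippable i F).card ≤ 12 := by
  by_contra! hcon
  have hall : ∀ a j, x + Pi.single (p j) 1 + Pi.single (p a) 1 ∈ F := by
    intro a
    by_contra! h
    exact absurd (hF.card_flippable_le hp hx a h) (not_le.2 (hcon _))
  -- A place outside the star tells the vectors below from complements of leaves.
  obtain ⟨m, hm⟩ : ∃ m, ∀ j, p j ≠ m := by
    by_contra! h
    have := Fintype.card_le_of_surjective p h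
    rw [Fintype.card_fin, Fintype.card_fin] at this
    omega
  have hleaf : ∀ j, x + Pi.single (p 0) 1 + Pi.single (p j) 1 ∈ F := fun j => hall j 0
  -- `x + e₁ + e₂` differs from the centre `x + e₀` of the second star in three of its places.
  have hpar := hF.star_parity hp hleaf (hall 1 2) ?_
  · simp only [Pi.add_apply, Pi.single_apply, hp.eq_iff] at hpar
    have h2 : ∀ j, x (p j) + (if j = 2 then 1 else 0) + (if j = 1 then 1 else 0) +
        (x (p j) + if j = 0 then 1 else 0) =
        (if j = 2 then 1 else 0) + (if j = 1 then 1 else 0) +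
          (if j = 0 then (1 : ZMod 2) else 0) := by
      intro j
      linear_combination CharTwo.add_self_eq_zero (x (p j))
    simp_rw [h2] at hpar
    exact absurd hpar (by decide)
  · intro j
    constructor
    · intro h
      obtain ⟨k, hk, hk3⟩ : ∃ k, k ≠ j ∧ k ≠ (3 : Fin 4) :=
        (by decide : ∀ j : Fin 4, ∃ k, k ≠ j ∧ k ≠ (3 : Fin 4)) j
      have h2 := congrFun h (p k)
      simp only [Pi.add_apply, Pi.single_apply, hp.eq_iff, add_assoc] at h2
      have h3 := add_left_cancel h2
      rw [if_neg hk] at h3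
      clear h h2 hk
      revert k
      decide
    · intro h
      have h2 := congrFun h m
      simp only [Pi.add_apply, Pi.one_apply, Pi.single_eq_of_ne (hm _).symm, add_zero] at h2
      exact one_ne_zero (left_eq_add.1 h2)

end Star

theorem sum_card_flippable {n : ℕ} (F : Finset (Fin n → ZMod 2)) :
    ∑ i, (flippable i F).card =
      ∑ x ∈ F, (Finset.univ.filter fun i => x + Pi.single i 1 ∈ F).card := by
  simp_rw [flippable, Finset.card_filter]
  exact Finset.sum_comm

/-- Some contraction loses at most six members, or at most an average share of `3 / 2` times
the size of the family. -/
theorem IsAdmissible.exists_contraction {n : ℕ} (hn : 4 ≤ n)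
    {F : Finset (Fin (n + 1) → ZMod 2)} (hF : IsAdmissible F) :
    ∃ i, F.card ≤ (_root_.contraction i F).card + 6 ∨
      2 * (n + 1) * F.card ≤ 2 * (n + 1) * (_root_.contraction i F).card + 3 * F.card := by
  by_cases hdeg : ∃ x ∈ F, 4 ≤ (Finset.univ.filter fun i => x + Pi.single i 1 ∈ F).card
  · obtain ⟨x, -, hx⟩ := hdeg
    obtain ⟨i, hi⟩ := hF.exists_card_flippable_le (by omega)
      (p := Finset.orderEmbOfCardLe _ hx) (x := x) (Finset.orderEmbOfCardLe _ hx).injective fun j =>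
        (Finset.mem_filter.1 (Finset.orderEmbOfCardLe_mem _ hx j)).2
    have := card_le_card_contraction F i
    exact ⟨i, Or.inl (by omega)⟩
  · push Not at hdeg
    have hsum : ∑ i, (flippable i F).card ≤ 3 * F.card := by
      rw [sum_card_flippable, mul_comm, ← smul_eq_mul]
      exact Finset.sum_le_card_nsmul _ _ _ fun x hx => by have := hdeg x hx; omega
    obtain ⟨i, hi⟩ : ∃ i, (n + 1) * (flippable i F).card ≤ 3 * F.card := by
      by_contra! h
      have h2 : ∑ _i : Fin (n + 1), 3 * F.card < ∑ i, (n + 1) * (flippable i F).card :=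
        Finset.sum_lt_sum_of_nonempty Finset.univ_nonempty fun i _ => h i
      rw [Finset.sum_const, Finset.card_univ, Fintype.card_fin, smul_eq_mul,
        ← Finset.mul_sum] at h2
      exact absurd (Nat.mul_le_mul_left (n + 1) hsum) (not_le.2 h2)
    refine ⟨i, Or.inr ?_⟩
    have := Nat.mul_le_mul_left (n + 1) (card_le_card_contraction F i)
    linarith

/-! ### Admissible families in dimension five -/

section Five

/-- The unit vector of `(ℤ/2ℤ)⁵` at the place `i`. -/
def unitVec (i : Fin 5) : Fin 5 → ZMod 2 := Pi.single i 1

/-- In dimension five, no scattered quadruple has five odd places. For the quadruple consisting of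
`c + e_k` with `k ≠ l, m` and of `c + e_l + e_m`, all five places are odd. -/
theorem IsAdmissible.add_unitVec_notMem {F : Finset (Fin 5 → ZMod 2)} (hF : IsAdmissible F)
    {c : Fin 5 → ZMod 2} {m : Fin 5} (hc : ∀ l, l ≠ m → c + unitVec l ∈ F) {l : Fin 5}
    (hl : l ≠ m) : c + (unitVec l + unitVec m) ∉ F := by
  intro hlm
  obtain ⟨p, hp, rfl, rfl⟩ : ∃ p : Fin 5 → Fin 5, Function.Injective p ∧ p 3 = l ∧ p 4 = m := by
    let σ : Equiv.Perm (Fin 5) := Equiv.swap 4 m * Equiv.swap 3 (Equiv.swap 4 m l)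
    refine ⟨σ, σ.injective, ?_, ?_⟩
    · simp [σ]
    · have h : Equiv.swap 4 m l ≠ 4 := by
        intro h
        rw [Equiv.swap_apply_eq_iff, Equiv.swap_apply_left] at h
        exact hl h
      rw [Equiv.Perm.mul_apply, Equiv.swap_apply_of_ne_of_ne (a := 3) (by decide) h.symm,
        Equiv.swap_apply_left]
  let d : Fin 4 → Fin 5 → ZMod 2 := fun j =>
    unitVec (p j.castSucc) + if j = 3 then unitVec (p 4) else 0
  have hd : ∀ j i, d j (p i) =
      (if i = j.castSucc then 1 else 0) + if j = 3 then (if i = 4 then 1 else 0) else 0 := by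
    intro j i
    simp only [d, unitVec, Pi.add_apply, Pi.single_apply, hp.eq_iff]
    split_ifs <;> simp_all [hp.eq_iff]
  have hmem : ∀ j, c + d j ∈ F := by
    intro j
    by_cases hj : j = 3
    · subst hj; exact hlm
    · simp only [d, if_neg hj, add_zero]
      refine hc _ fun h => ?_
      have := hp h
      clear h
      revert j
      decide
  have hscat : IsScattered fun j => c + d j := by
    intro j
    refine ⟨p j.castSucc, fun k hk => ?_⟩
    simp only [Pi.add_apply, add_assoc, hd]
    congr 1
    revert j k
    decide
  have hodd : ∀ i, ∑ j, (c + d j) i = 1 := by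
    intro i
    obtain ⟨i, rfl⟩ := (Finite.injective_iff_surjective.1 hp) i
    simp only [Pi.add_apply, Finset.sum_add_distrib, hd, Finset.sum_const, Finset.card_univ,
      Fintype.card_fin, nsmul_eq_mul]
    rw [(by decide : ((4 : ℕ) : ZMod 2) = 0), zero_mul, zero_add]
    revert i
    decide
  have h := hF.card_le _ hmem hscat
  simp only [hodd, Finset.filter_true, Finset.card_univ, Fintype.card_fin] at h
  omega

theorem card_add_card_le_of_disjoint_translate {F W : Finset (Fin 5 → ZMod 2)}
    (c : Fin 5 → ZMod 2) (h : ∀ w ∈ W, c + w ∉ F) : F.card + W.card ≤ 32 := by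
  have hd : Disjoint F (W.image fun w => c + w) := by
    rw [Finset.disjoint_right]
    intro x hx
    obtain ⟨w, hw, rfl⟩ := Finset.mem_image.1 hx
    exact h w hw
  rw [← Finset.card_image_of_injective W (add_right_injective c),
    ← Finset.card_union_of_disjoint hd]
  exact (Finset.card_le_univ _).trans (by simp [ZMod.card])

/-- The `32` vectors have `5 |F| > 3 * 32` neighbours in `F` altogether. -/
theorem exists_four_neighbours {F : Finset (Fin 5 → ZMod 2)} (hF : 20 < F.card) :
    ∃ (c : Fin 5 → ZMod 2) (m : Fin 5), ∀ l, l ≠ m → c + unitVec l ∈ F := by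
  obtain ⟨c, hc⟩ : ∃ c : Fin 5 → ZMod 2,
      3 < (Finset.univ.filter fun i => c + unitVec i ∈ F).card := by
    by_contra! h
    have h1 : ∑ c : Fin 5 → ZMod 2, (Finset.univ.filter fun i => c + unitVec i ∈ F).card ≤
        32 * 3 := by
      refine (Finset.sum_le_card_nsmul _ _ 3 fun c _ => h c).trans (le_of_eq ?_)
      simp [ZMod.card]
    have h2 : ∑ c : Fin 5 → ZMod 2, (Finset.univ.filter fun i => c + unitVec i ∈ F).card =
        5 * F.card := by
      simp_rw [Finset.card_filter]
      rw [Finset.sum_comm]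
      have h3 : ∀ i : Fin 5, ∑ c : Fin 5 → ZMod 2, (if c + unitVec i ∈ F then 1 else 0) =
          F.card := by
        intro i
        refine (Equiv.sum_comp (Equiv.addRight (unitVec i))
          fun c => if c ∈ F then 1 else 0).trans ?_
        simp
      simp_rw [h3]
      simp
    omega
  have hle : (Finset.univ.filter fun i => c + unitVec i ∉ F).card ≤ 1 := by
    have := Finset.card_filter_add_card_filter_not (s := (Finset.univ : Finset (Fin 5)))
      (fun i => c + unitVec i ∈ F)
    rw [Finset.card_univ, Fintype.card_fin] at this
    omega
  rw [Finset.card_le_one_iff_subset_singleton] at hle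
  obtain ⟨m, hm⟩ := hle
  refine ⟨c, m, fun l hl => ?_⟩
  by_contra hmem
  exact hl (Finset.mem_singleton.1 (hm (Finset.mem_filter.2 ⟨Finset.mem_univ _, hmem⟩)))

/-- The vectors `e_m` and `e_l + e_m` with `l ≠ m`, and their complements. -/
def excluded (m : Fin 5) : Finset (Fin 5 → ZMod 2) :=
  Finset.univ.image (fun l => if l = m then unitVec m else unitVec l + unitVec m) ∪
    Finset.univ.image (fun l => if l = m then unitVec m + 1 else unitVec l + unitVec m + 1)

/-- The sums of two distinct unit vectors, and their complements. -/
def pairSums : Finset (Fin 5 → ZMod 2) :=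
  Finset.univ.offDiag.image (fun q : Fin 5 × Fin 5 => unitVec q.1 + unitVec q.2) ∪
    Finset.univ.offDiag.image (fun q : Fin 5 × Fin 5 => unitVec q.1 + unitVec q.2 + 1)

theorem card_pairSums : pairSums.card = 20 := by decide

theorem card_excluded (m : Fin 5) : (excluded m).card = 10 := by revert m; decide

theorem add_one_mem_excluded (m : Fin 5) : ∀ v ∈ excluded m, v + 1 ∈ excluded m := by
  revert m; decide

theorem two_notMem_excluded (m l k : Fin 5) (hl : l ≠ m) (hk : k ≠ m) :
    unitVec l + unitVec k ∉ excluded m := by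
  revert m l k; decide

theorem three_notMem_excluded (m l k : Fin 5) (h : l ≠ m ∧ k ≠ m ∧ l ≠ k) :
    unitVec l + (unitVec k + unitVec m) ∉ excluded m := by
  revert m l k; decide

theorem IsAdmissible.add_one_notMem {n : ℕ} {F : Finset (Fin n → ZMod 2)} (hF : IsAdmissible F)
    {x : Fin n → ZMod 2} (hx : x ∉ F) : x + 1 ∉ F := fun h => hx <| by
  have := hF.add_one_mem _ h
  rwa [add_assoc, signVector_add_self, add_zero] at this

/-- If there were more than twenty vectors, some `c` would have four neighbours in `F`; this forces
the complement of `F` to be a translate of `excluded m`, and then the same argument applied at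
another centre `c + e_l` excludes a further vector. -/
theorem IsAdmissible.card_le_twenty {F : Finset (Fin 5 → ZMod 2)} (hF : IsAdmissible F) :
    F.card ≤ 20 := by
  by_contra! hcard
  obtain ⟨c, m, hc⟩ := exists_four_neighbours hcard
  have hcm : c + unitVec m ∉ F := by
    intro h
    have hall : ∀ l, c + unitVec l ∈ F := by
      intro l
      by_cases hl : l = m
      · rwa [hl]
      · exact hc l hl
    have h1 : ∀ l k, l ≠ k → c + (unitVec l + unitVec k) ∉ F := fun l k hlk =>
      hF.add_unitVec_notMem (fun l _ => hall l) hlk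
    have h2 : F.card + pairSums.card ≤ 32 := by
      refine card_add_card_le_of_disjoint_translate c fun w hw => ?_
      rcases Finset.mem_union.1 hw with hw | hw <;>
        obtain ⟨q, hq, rfl⟩ := Finset.mem_image.1 hw
      · exact h1 _ _ (Finset.mem_offDiag.1 hq).2.2
      · rw [← add_assoc]
        exact hF.add_one_notMem (h1 _ _ (Finset.mem_offDiag.1 hq).2.2)
    rw [card_pairSums] at h2
    omega
  have hexcl : ∀ w ∈ excluded m, c + w ∉ F := by
    intro w hw
    rcases Finset.mem_union.1 hw with hw | hw <;>
      obtain ⟨l, -, rfl⟩ := Finset.mem_image.1 hw <;> split_ifs with hl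
    · exact hcm
    · exact hF.add_unitVec_notMem hc hl
    · rw [← add_assoc]
      exact hF.add_one_notMem hcm
    · rw [← add_assoc]
      exact hF.add_one_notMem (hF.add_unitVec_notMem hc hl)
  have hrest : ∀ v, v ∉ excluded m → c + v ∈ F := by
    intro v hv
    by_contra hvF
    have hv1 : v + 1 ∉ excluded m := fun h => hv <| by
      have := add_one_mem_excluded m _ h
      rwa [add_assoc, signVector_add_self, add_zero] at this
    have hne : v ≠ v + 1 := fun h => by
      have := congrFun h 0
      simp at this
    have h := card_add_card_le_of_disjoint_translate (F := F)
      (W := insert v (insert (v + 1) (excluded m))) c ?_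
    · rw [Finset.card_insert_of_notMem, Finset.card_insert_of_notMem hv1, card_excluded] at h
      · omega
      · rw [Finset.mem_insert, not_or]
        exact ⟨hne, hv⟩
    · intro w hw
      rw [Finset.mem_insert, Finset.mem_insert] at hw
      rcases hw with rfl | rfl | hw
      · exact hvF
      · rw [← add_assoc]
        exact hF.add_one_notMem hvF
      · exact hexcl w hw
  obtain ⟨l, k, hl, hk, hlk⟩ : ∃ l k, l ≠ m ∧ k ≠ m ∧ k ≠ l :=
    (by decide : ∀ m : Fin 5, ∃ l k, l ≠ m ∧ k ≠ m ∧ k ≠ l) m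
  have hc' : ∀ j, j ≠ m → c + unitVec l + unitVec j ∈ F := by
    intro j hj
    rw [add_assoc]
    exact hrest _ (two_notMem_excluded m l j hl hj)
  refine hF.add_unitVec_notMem hc' hk ?_
  rw [add_assoc]
  exact hrest _ (three_notMem_excluded m l k ⟨hl, hk, hlk.symm⟩)

end Five

/-! ### Bounds for admissible families -/

theorem IsAdmissible.card_le_twenty_six {F : Finset (Fin 6 → ZMod 2)} (hF : IsAdmissible F) :
    F.card ≤ 26 := by
  obtain ⟨i, h⟩ := hF.exists_contraction (by norm_num)
  have := (hF.contraction i).card_le_twenty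
  omega

theorem IsAdmissible.card_le_thirty_three {F : Finset (Fin 7 → ZMod 2)} (hF : IsAdmissible F) :
    F.card ≤ 33 := by
  obtain ⟨i, h⟩ := hF.exists_contraction (by norm_num)
  have := (hF.contraction i).card_le_twenty_six
  omega

/-- For `n ≥ 11` with `n ≡ 1 (mod 6)` the right-hand side is `18 * (kissingBound n - n)`; in the
other residue classes the table leaves more room. -/
theorem IsAdmissible.nine_mul_card_le {n : ℕ} (hn : 6 ≤ n) {F : Finset (Fin n → ZMod 2)}
    (hF : IsAdmissible F) : 9 * (F.card : ℝ) ≤ 4 * n ^ 2 + 22 * n - 26 := by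
  induction n, hn using Nat.le_induction with
  | base =>
    have h : (F.card : ℝ) ≤ 26 := by exact_mod_cast hF.card_le_twenty_six
    norm_num
    linarith
  | succ n hn ih =>
    obtain ⟨i, h⟩ := hF.exists_contraction (by omega)
    have ih := ih (hF.contraction i)
    have hn' : (6 : ℝ) ≤ n := by exact_mod_cast hn
    push_cast
    rcases h with h | h
    -- A loss of `6` is below the increment `8 n + 26` of the bound, divided by `9`.
    · have h' : (F.card : ℝ) ≤ (_root_.contraction i F).card + 6 := by exact_mod_cast h
      linarith
    · have h' : 2 * ((n : ℝ) + 1) * F.card ≤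
          2 * (n + 1) * (_root_.contraction i F).card + 3 * F.card := by exact_mod_cast h
      generalize (F.card : ℝ) = f at *
      generalize ((_root_.contraction i F).card : ℝ) = g at *
      have h1 : (2 * (n : ℝ) - 1) * (9 * f) ≤ (2 * (n : ℝ) - 1) *
          (4 * (n + 1) ^ 2 + 22 * (n + 1) - 26) := by
        have h2 := mul_le_mul_of_nonneg_left ih (by linarith : 0 ≤ 2 * ((n : ℝ) + 1))
        nlinarith
      exact le_of_mul_le_mul_left h1 (by linarith)

/-! ### The table of bounds -/

theorem kissingBound_bounds {n : ℕ} (hn : 11 ≤ n) :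
    (2 * (n : ℝ) ^ 2 + 20 * n - 13) / 9 ≤ kissingBound n ∧
      kissingBound n ≤ (2 * (n : ℝ) ^ 2 + 24 * n) / 9 := by
  have hn' : (11 : ℝ) ≤ n := by exact_mod_cast hn
  unfold kissingBound
  rw [if_neg (by omega), if_neg (by omega), if_neg (by omega), if_neg (by omega),
    if_neg (by omega)]
  split_ifs <;> constructor <;> linarith

theorem kissingBound_lt {n : ℕ} (hn : 6 ≤ n) : kissingBound n < (n : ℝ) * (n + 1) / 2 := by
  rcases lt_or_ge n 11 with h | h
  · interval_cases n <;> norm_num [kissingBound]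
  · have hn' : (11 : ℝ) ≤ n := by exact_mod_cast h
    have := (kissingBound_bounds h).2
    nlinarith

theorem kissingBound_le_mul {n : ℕ} (hn : 11 ≤ n) :
    kissingBound n ≤ (1 + 12 / n) * (2 * (n : ℝ) ^ 2 / 9) := by
  have hn' : (0 : ℝ) < n := by exact_mod_cast (by omega : 0 < n)
  refine (kissingBound_bounds hn).2.trans (le_of_eq ?_)
  field_simp
  ring

theorem isEquivalent_kissingBound :
    (fun n : ℕ => kissingBound n) ~[atTop] (fun n : ℕ => 2 * (n : ℝ) ^ 2 / 9) := by
  apply isEquivalent_of_tendsto_one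
  have hlim : Tendsto (fun n : ℕ => 1 + 12 / (n : ℝ)) atTop (nhds 1) := by
    simpa using (tendsto_const_div_atTop_nhds_zero_nat (12 : ℝ)).const_add 1
  refine tendsto_of_tendsto_of_tendsto_of_le_of_le' tendsto_const_nhds hlim ?_ ?_ <;>
    filter_upwards [eventually_ge_atTop 11] with n hn
  all_goals
    have hn' : (11 : ℝ) ≤ n := by exact_mod_cast hn
    have hpos : (0 : ℝ) < 2 * (n : ℝ) ^ 2 / 9 := by positivity
  · rw [Pi.div_apply, le_div_iff₀ hpos]
    have := (kissingBound_bounds hn).1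
    linarith
  · rw [Pi.div_apply, div_le_iff₀ hpos]
    exact kissingBound_le_mul hn

theorem IsAdmissible.add_card_div_two_le {n : ℕ} (hn : 6 ≤ n) {F : Finset (Fin n → ZMod 2)}
    (hF : IsAdmissible F) : n + (F.card : ℝ) / 2 ≤ kissingBound n := by
  have h := hF.nine_mul_card_le hn
  rcases lt_or_ge n 11 with h11 | h11
  · by_cases h6 : n = 6
    · subst h6
      have h : (F.card : ℝ) ≤ 26 := by exact_mod_cast hF.card_le_twenty_six
      norm_num [kissingBound]
      linarith
    by_cases h7 : n = 7
    · subst h7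
      have h : (F.card : ℝ) ≤ 33 := by exact_mod_cast hF.card_le_thirty_three
      norm_num [kissingBound]
      linarith
    have h8 : 8 ≤ n := by omega
    clear h6 h7 hn hF
    generalize (F.card : ℝ) = f at *
    interval_cases n <;> norm_num [kissingBound] at h ⊢ <;> linarith
  · have := (kissingBound_bounds h11).1
    linarith

theorem halfKissingNumber_le_kissingBound {n : ℕ} (hn : 6 ≤ n) {E : Type*}
    [NormedAddCommGroup E] [InnerProductSpace ℝ E] [FiniteDimensional ℝ E]
    {L : Submodule ℤ E} [DiscreteTopology L] [IsZLattice ℝ L]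
    (hdim : Module.finrank ℝ E = n) (hL : HasMaximalIndex L 2) (hlen : HasLength L n) :
    halfKissingNumber L ≤ kissingBound n := by
  obtain ⟨b, hb⟩ := exists_isHalfFrame hdim hlen
  exact (halfKissingNumber_le hL hlen (by omega) hb).trans
    ((isAdmissible_signVectors hL hlen hb).add_card_div_two_le hn)

theorem mainTheorem2 :
    -- the table of bounds
    (∀ (n : ℕ), 6 ≤ n →
      ∀ (E : Type u) [NormedAddCommGroup E] [InnerProductSpace ℝ E] [FiniteDimensional ℝ E]
        (L : Submodule ℤ E) [DiscreteTopology L] [IsZLattice ℝ L],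
        Module.finrank ℝ E = n → HasMaximalIndex L 2 → HasLength L n →
          halfKissingNumber L ≤ kissingBound n) ∧
    -- each bound is strictly below `n(n+1)/2`
    (∀ n : ℕ, 6 ≤ n → kissingBound n < (n : ℝ) * (n + 1) / 2) ∧
    -- the bounds are asymptotic to `2n²/9`
    (fun n : ℕ => kissingBound n) ~[atTop] (fun n : ℕ => 2 * (n : ℝ) ^ 2 / 9) ∧
    -- hence asymptotically `s ≤ 2n²/9`, uniformly over all lattices considered
    (∀ ε : ℝ, 0 < ε → ∃ N : ℕ, ∀ (n : ℕ), 6 ≤ n → N ≤ n →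
      ∀ (E : Type u) [NormedAddCommGroup E] [InnerProductSpace ℝ E] [FiniteDimensional ℝ E]
        (L : Submodule ℤ E) [DiscreteTopology L] [IsZLattice ℝ L],
        Module.finrank ℝ E = n → HasMaximalIndex L 2 → HasLength L n →
          halfKissingNumber L ≤ (1 + ε) * (2 * (n : ℝ) ^ 2 / 9)) := by
  refine ⟨fun n hn E _ _ _ L _ _ hdim hL hlen =>
      halfKissingNumber_le_kissingBound hn hdim hL hlen,
    fun n hn => kissingBound_lt hn, isEquivalent_kissingBound, fun ε hε => ?_⟩
  obtain ⟨N, hN⟩ := exists_nat_gt (12 / ε)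
  refine ⟨max 11 N, fun n hn hNn E _ _ _ L _ _ hdim hL hlen => ?_⟩
  have h11 : 11 ≤ n := (le_max_left _ _).trans hNn
  have hNn' : (N : ℝ) ≤ n := by exact_mod_cast (le_max_right _ _).trans hNn
  have hn' : (0 : ℝ) < n := by exact_mod_cast (by omega : 0 < n)
  have hε' : 12 / (n : ℝ) ≤ ε := by
    rw [div_le_iff₀ hn', ← div_le_iff₀' hε]
    linarith
  refine (halfKissingNumber_le_kissingBound hn hdim hL hlen).trans
    ((kissingBound_le_mul h11).trans ?_)
  gcongr
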